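/- **Definitions.** Let $X$ be a real or complex Banach space. For $x\in X$ and nonempty $A,B\subset X$ put $E(x,A)=\inf_{a\in A}\|x-a\|$ and $E(B,A)=\sup_{b\in B}E(b,A)$. An *approximation scheme* $(X,\{A_n\})$ is a strictly increasing sequence $A_0\subsetneq A_1\subsetneq\cdots$ of nonempty subsets of $X$ such that (i) there is a map $K:\mathbb N\to\mathbb N$ with $K(n)\ge n$ and $A_n+A_n\subseteq A_{K(n)}$ for all $n$; (ii) $\lambda A_n\subseteq A_n$ for all $n$ and all scalars $\lambda$; (iii) $\bigcup_n A_n$ is dense in $X$. It *satisfies Shapiro's Theorem* if for every non-increasing sequence $(\varepsilon_n)$ of reals with $\varepsilon_n\to 0$ there is $x\in X$ with $E(x,A_n)\ne \mathbf O(\varepsilon_n)$. A linear subspace $Y\subseteq X$, with the norm inherited from $X$ and unit sphere $S(Y)=\{y\in Y:\|y\|=1\}$, is *$1$-far* from $(A_n)$ if $E(S(Y),A_n)\ge 1$ for every $n$. A subspace $Y$ of finite codimension has the *Defining Subspace Property* (DSP) if for every $\varepsilon>0$ there are $\delta>0$ and a finite dimensional subspace $F\subseteq X$ such that every $x\in X$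 with $\|x\|\le 1$ and $E(x,F)>1-\delta$ satisfies $E(x,Y)\le\varepsilon$. $X$ has the *Reverse Metric Approximation Property* (RMAP) if for every finite dimensional subspace $F\subseteq X$ and every $\delta>0$ there is a bounded finite rank operator $u:X\to X$ with $u|_F=I_F$ and $\|I_X-u\|<1+\delta$. $X$ is *uniformly convex* if for every $\varepsilon>0$ there is $\delta>0$ such that $\|x+y\|\le 2-\delta$ whenever $\|x\|=\|y\|=1$ and $\|x-y\|\ge\varepsilon$. **Theorem.** Let $X$ be a real or complex Banach space. 1. If an approximation scheme $(X,\{A_n\})$ satisfies Shapiro's Theorem and $Y$ is a finite codimensional subspace of $X$ with the DSP, then $Y$ is $1$-far from $(A_n)$. 2. If $X$ is uniformly convex and has the RMAP, then every finite codimensional subspace of $X$ has the DSP. Consequently, if $X$ is uniformly convex and has the RMAP, and an approximation scheme $(X,\{A_n\})$ satisfies Shapiro's Theorem, then every finite codimensional subspace of $X$ is $1$-far from $(A_n)$. -/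

import Mathlib

open Filter Topology Asymptotics

namespace ApproxLethargy

/-- `A 0 ⊂ A 1 ⊂ ...` (strict inclusions) is an approximation scheme in the normed space `X`.
The sets are nonempty, so that best approximation errors are infima of nonempty sets. -/
structure IsApproximationScheme (𝕜 : Type*) {X : Type*} [RCLike 𝕜] [NormedAddCommGroup X]
    [NormedSpace 𝕜 X] (A : ℕ → Set X) : Prop where
  nonempty : ∀ n, (A n).Nonempty
  ssubset_succ : ∀ n, A n ⊂ A (n + 1)
  exists_add_mem : ∃ K : ℕ → ℕ, ∀ n, n ≤ K n ∧ ∀ a ∈ A n, ∀ b ∈ A n, a + b ∈ A (K n)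
  smul_mem : ∀ n, ∀ c : 𝕜, ∀ a ∈ A n, c • a ∈ A n
  dense_iUnion : Dense (⋃ n, A n)

/-- The error `E(x, A) = inf_{a ∈ A} ‖x - a‖` of best approximation of `x` by `A`
(used for nonempty `A` only). -/
noncomputable def bestError {X : Type*} [NormedAddCommGroup X] (x : X) (A : Set X) : ℝ :=
  Metric.infDist x A

/-- `E(B, A) = sup_{b ∈ B} E(b, A)`. It is used for subsets `B` of the unit sphere and sets `A`
containing `0`, so the errors involved are bounded by `1`. -/
noncomputable def setError {X : Type*} [NormedAddCommGroup X] (B A : Set X) : ℝ :=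
  sSup ((fun b => bestError b A) '' B)

/-- `(X, {A n})` satisfies Shapiro's theorem: for each sequence `ε n` decreasing to `0` (in the
weak sense) there is `x` with `E(x, A n) ≠ O(ε n)`. -/
def SatisfiesShapiro {X : Type*} [NormedAddCommGroup X] (A : ℕ → Set X) : Prop :=
  ∀ ε : ℕ → ℝ, Antitone ε → Tendsto ε atTop (𝓝 0) →
    ∃ x : X, ¬ ((fun n => bestError x (A n)) =O[atTop] ε)

/-- The unit sphere `S(Y)` of a subspace `Y` of `X` with the inherited norm. -/
def unitSphere {𝕜 X : Type*} [RCLike 𝕜] [NormedAddCommGroup X] [NormedSpace 𝕜 X]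
    (Y : Submodule 𝕜 X) : Set X :=
  {y | y ∈ Y ∧ ‖y‖ = 1}

/-- The subspace `Y` is `c`-far from `(A n)`: `E(S(Y), A n) ≥ c` for all `n`. -/
def IsFar {𝕜 X : Type*} [RCLike 𝕜] [NormedAddCommGroup X] [NormedSpace 𝕜 X]
    (c : ℝ) (Y : Submodule 𝕜 X) (A : ℕ → Set X) : Prop :=
  ∀ n, c ≤ setError (unitSphere Y) (A n)

/-- `F` is `(ε, δ)`-defining for `Y`. -/
def IsDefining {𝕜 X : Type*} [RCLike 𝕜] [NormedAddCommGroup X] [NormedSpace 𝕜 X]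
    (ε δ : ℝ) (F Y : Submodule 𝕜 X) : Prop :=
  ∀ x : X, ‖x‖ ≤ 1 → 1 - δ < bestError x (F : Set X) → bestError x (Y : Set X) ≤ ε

/-- The Defining Subspace Property of a finite codimensional subspace `Y`. -/
def HasDSP {𝕜 X : Type*} [RCLike 𝕜] [NormedAddCommGroup X] [NormedSpace 𝕜 X]
    (Y : Submodule 𝕜 X) : Prop :=
  ∀ ε : ℝ, 0 < ε → ∃ δ : ℝ, 0 < δ ∧
    ∃ F : Submodule 𝕜 X, FiniteDimensional 𝕜 F ∧ IsDefining ε δ F Y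

/-- The Reverse Metric Approximation Property of `X`. -/
def HasRMAP (𝕜 X : Type*) [RCLike 𝕜] [NormedAddCommGroup X] [NormedSpace 𝕜 X] : Prop :=
  ∀ F : Submodule 𝕜 X, FiniteDimensional 𝕜 F → ∀ δ : ℝ, 0 < δ →
    ∃ u : X →L[𝕜] X, FiniteDimensional 𝕜 (LinearMap.range (u : X →ₗ[𝕜] X)) ∧
      (∀ x ∈ F, u x = x) ∧ ‖ContinuousLinearMap.id 𝕜 X - u‖ < 1 + δ

end ApproxLethargy

/-! Part 1: if the errors of approximation by `A n + F` on the unit ball stayed below some `c < 1`,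
with `F` finite dimensional, then `F` could be stripped off line by line, leaving some `A k` with
uniform relative error below `1`. Iterating on remainders sends the worst errors to `0`,
contradicting Shapiro's theorem. So some `x` has error near `1` from `A n + F`: it is far from `F`,
hence near `Y` by the DSP, and far from `A n`. A nearby vector of `Y`, normalised, is the required
one. Part 2: finitely many functionals control the distance to `Y`. The RMAP and uniform convexity
give a nearly contractive `v`, with `1 - v` of finite rank, making all of them small after
composition (`HasRMAP.exists_norm_comp_le`, iterated). If `x` is far from the range of `1 - v`, the
midpoint of `x` and `v x` has norm near `1`, so `x` is close to `v x`, which is close to `Y`. -/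

namespace ApproxLethargy

open scoped Pointwise

/-! ### Approximation schemes and finite dimensional summands -/

section Scheme

variable {𝕜 X : Type*} [RCLike 𝕜] [NormedAddCommGroup X] [NormedSpace 𝕜 X]

/-- An increasing sequence of sets with the algebraic and density properties of an approximation
scheme, the inclusions not being required to be strict. -/
structure IsWeakScheme (𝕜 : Type*) {X : Type*} [RCLike 𝕜] [NormedAddCommGroup X]
    [NormedSpace 𝕜 X] (A : ℕ → Set X) : Prop where
  monotone : Monotone A
  zero_mem : ∀ n, (0 : X) ∈ A n
  exists_add_mem : ∀ n, ∃ k, n ≤ k ∧ ∀ a ∈ A n, ∀ b ∈ A n, a + b ∈ A k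
  smul_mem : ∀ n, ∀ c : 𝕜, ∀ a ∈ A n, c • a ∈ A n
  dense_iUnion : Dense (⋃ n, A n)

theorem IsApproximationScheme.isWeakScheme {A : ℕ → Set X} (h : IsApproximationScheme 𝕜 A) :
    IsWeakScheme 𝕜 A where
  monotone := monotone_nat_of_le_succ fun n => (h.ssubset_succ n).subset
  zero_mem n := by
    obtain ⟨a, ha⟩ := h.nonempty n
    simpa using h.smul_mem n 0 a ha
  exists_add_mem n := by
    obtain ⟨K, hK⟩ := h.exists_add_mem
    exact ⟨K n, hK n⟩
  smul_mem := h.smul_mem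
  dense_iUnion := h.dense_iUnion

/-- Every vector is approximated by `S` with relative error at most `c`. -/
def ApproximatesWithin (S : Set X) (c : ℝ) : Prop :=
  ∀ x : X, ∃ a ∈ S, ‖x - a‖ ≤ c * ‖x‖

theorem ApproximatesWithin.mono {S T : Set X} {c d : ℝ} (h : ApproximatesWithin S c)
    (hST : S ⊆ T) (hcd : c ≤ d) : ApproximatesWithin T d := fun x => by
  obtain ⟨a, ha, hx⟩ := h x
  exact ⟨a, hST ha, hx.trans (by gcongr)⟩

namespace IsWeakScheme

variable {A : ℕ → Set X}

/-- Approximating the remainder `x - a` once more multiplies the relative errors. -/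
theorem exists_approximatesWithin_pow (hA : IsWeakScheme 𝕜 A) {m : ℕ} {c : ℝ}
    (h : ApproximatesWithin (A m) c) (hc : 0 ≤ c) (j : ℕ) :
    ∃ k, m ≤ k ∧ ApproximatesWithin (A k) (c ^ j) := by
  induction j with
  | zero => exact ⟨m, le_rfl, fun x => ⟨0, hA.zero_mem m, by simp⟩⟩
  | succ j ih =>
    obtain ⟨k, hmk, hk⟩ := ih
    obtain ⟨l, hkl, hl⟩ := hA.exists_add_mem k
    refine ⟨l, hmk.trans hkl, fun x => ?_⟩
    obtain ⟨a, ha, hxa⟩ := h x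
    obtain ⟨b, hb, hxb⟩ := hk (x - a)
    refine ⟨a + b, hl _ (hA.monotone hmk ha) _ hb, ?_⟩
    calc ‖x - (a + b)‖ = ‖x - a - b‖ := by rw [sub_sub]
      _ ≤ c ^ j * ‖x - a‖ := hxb
      _ ≤ c ^ j * (c * ‖x‖) := by gcongr
      _ = c ^ (j + 1) * ‖x‖ := by ring

theorem exists_approximatesWithin (hA : IsWeakScheme 𝕜 A) {m : ℕ} {c : ℝ}
    (h : ApproximatesWithin (A m) c) (hc : c < 1) {η : ℝ} (hη : 0 < η) :
    ∃ k, m ≤ k ∧ ApproximatesWithin (A k) η := by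
  obtain ⟨j, hj⟩ := exists_pow_lt_of_lt_one hη (max_lt hc zero_lt_one)
  obtain ⟨k, hmk, hk⟩ := hA.exists_approximatesWithin_pow
    (h.mono subset_rfl (le_max_left c 0)) (le_max_right c 0) j
  exact ⟨k, hmk, hk.mono subset_rfl hj.le⟩

/-- Strictness of the inclusions could be lost here, which is why weak schemes are used. -/
theorem add_submodule (hA : IsWeakScheme 𝕜 A) (F : Submodule 𝕜 X) :
    IsWeakScheme 𝕜 fun n => A n + (F : Set X) where
  monotone _ _ h := Set.add_subset_add_right (hA.monotone h)
  zero_mem n := ⟨0, hA.zero_mem n, 0, F.zero_mem, by simp⟩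
  exists_add_mem n := by
    obtain ⟨k, hnk, hk⟩ := hA.exists_add_mem n
    refine ⟨k, hnk, ?_⟩
    rintro _ ⟨a, ha, f, hf, rfl⟩ _ ⟨b, hb, g, hg, rfl⟩
    exact ⟨a + b, hk a ha b hb, f + g, F.add_mem hf hg, add_add_add_comm _ _ _ _⟩
  smul_mem n c := by
    rintro _ ⟨a, ha, f, hf, rfl⟩
    exact ⟨c • a, hA.smul_mem n c a ha, c • f, F.smul_mem c hf, (smul_add _ _ _).symm⟩
  dense_iUnion := hA.dense_iUnion.mono <| Set.iUnion_mono fun n x hx =>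
    ⟨x, hx, 0, F.zero_mem, add_zero x⟩

theorem exists_mem_norm_sub_lt (hA : IsWeakScheme 𝕜 A) (x : X) {η : ℝ} (hη : 0 < η) (m : ℕ) :
    ∃ k, m ≤ k ∧ ∃ a ∈ A k, ‖x - a‖ < η := by
  obtain ⟨a, ha, hxa⟩ := hA.dense_iUnion.exists_dist_lt x hη
  obtain ⟨k, hk⟩ := Set.mem_iUnion.1 ha
  exact ⟨max m k, le_max_left _ _, a, hA.monotone (le_max_right m k) hk, by rwa [← dist_eq_norm]⟩

/-- If every vector is approximated by `A m` plus a line, then the coefficients on the line are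
bounded unless the line lies in the closure of some `A M`. -/
theorem approximatesWithin_of_add_span_singleton (hA : IsWeakScheme 𝕜 A) (f : X) {m : ℕ} {c : ℝ}
    (h : ApproximatesWithin (A m + (Submodule.span 𝕜 {f} : Set X)) c) (hc : c < 1) :
    ∃ k, ∃ d < 1, ApproximatesWithin (A k) d := by
  obtain ⟨j, -, hj⟩ := (hA.add_submodule (Submodule.span 𝕜 {f})).exists_approximatesWithin h hc
    (show (0 : ℝ) < 1 / 4 by norm_num)
  -- By homogeneity, a positive distance from `f` to `A j` bounds the coefficient `t` by the norm of
  -- `a + t • f`.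
  obtain hf | ⟨T, hT, hTb⟩ : f ∈ closure (A j) ∨
      ∃ T : ℝ, 0 < T ∧ ∀ a ∈ A j, ∀ t : 𝕜, ‖t‖ ≤ T * ‖a + t • f‖ := by
    refine or_iff_not_imp_left.2 fun hf => ?_
    have hd : 0 < Metric.infDist f (A j) :=
      (Metric.infDist_pos_iff_notMem_closure ⟨0, hA.zero_mem j⟩).1 hf
    refine ⟨(Metric.infDist f (A j))⁻¹, inv_pos.2 hd, fun a ha t => ?_⟩
    rcases eq_or_ne t 0 with rfl | ht
    · simp only [norm_zero]; positivity
    rw [inv_mul_eq_div, le_div_iff₀ hd]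
    have h1 := Metric.infDist_le_dist_of_mem (x := f) (hA.smul_mem j (-t⁻¹) a ha)
    calc ‖t‖ * Metric.infDist f (A j) ≤ ‖t‖ * dist f (-t⁻¹ • a) := by gcongr
      _ = ‖a + t • f‖ := by
        rw [dist_eq_norm, ← norm_smul, smul_sub, smul_smul, mul_neg, mul_inv_cancel₀ ht,
          neg_smul, one_smul, sub_neg_eq_add, add_comm]
  · obtain ⟨k, hjk, hk⟩ := hA.exists_add_mem j
    refine ⟨k, 1 / 2, by norm_num, fun x => ?_⟩
    rcases eq_or_ne x 0 with rfl | hx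
    · exact ⟨0, hA.zero_mem k, by simp⟩
    obtain ⟨_, ⟨a, ha, y, hy, rfl⟩, hxa⟩ := hj x
    obtain ⟨t, rfl⟩ := Submodule.mem_span_singleton.1 hy
    have hx0 : 0 < ‖x‖ := norm_pos_iff.2 hx
    have htc : t • f ∈ closure (A j) :=
      map_mem_closure (continuous_const_smul t) hf fun a ha => hA.smul_mem j t a ha
    obtain ⟨b, hb, hfb⟩ := Metric.mem_closure_iff.1 htc (‖x‖ / 4) (by positivity)
    rw [dist_eq_norm] at hfb
    refine ⟨a + b, hk _ ha _ hb, ?_⟩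
    calc ‖x - (a + b)‖ = ‖(x - (a + t • f)) + (t • f - b)‖ := by congr 1; abel
      _ ≤ _ := norm_add_le _ _
      _ ≤ 1 / 4 * ‖x‖ + ‖x‖ / 4 := add_le_add hxa hfb.le
      _ = 1 / 2 * ‖x‖ := by ring
  -- Since `‖t‖ ≤ T * (5 / 4 * ‖x‖)`, one fixed `b` replaces `f` for all `x` at a cost of at most `5
  -- / 32 * ‖x‖`.
  · obtain ⟨M, hjM, b, hb, hfb⟩ := hA.exists_mem_norm_sub_lt f
      (show (0 : ℝ) < 1 / (8 * T) by positivity) j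
    obtain ⟨k, hMk, hk⟩ := hA.exists_add_mem M
    refine ⟨k, 1 / 2, by norm_num, fun x => ?_⟩
    obtain ⟨_, ⟨a, ha, y, hy, rfl⟩, hxa⟩ := hj x
    obtain ⟨t, rfl⟩ := Submodule.mem_span_singleton.1 hy
    have hb' : ‖a + t • f‖ ≤ 5 / 4 * ‖x‖ := by
      calc ‖a + t • f‖ = ‖x - (x - (a + t • f))‖ := by congr 1; abel
        _ ≤ ‖x‖ + ‖x - (a + t • f)‖ := norm_sub_le _ _
        _ ≤ ‖x‖ + 1 / 4 * ‖x‖ := by gcongr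
        _ = _ := by ring
    refine ⟨a + t • b, hk _ (hA.monotone hjM ha) _ (hA.smul_mem M t b hb), ?_⟩
    calc ‖x - (a + t • b)‖ = ‖(x - (a + t • f)) + t • (f - b)‖ := by
          rw [smul_sub]; congr 1; abel
      _ ≤ ‖x - (a + t • f)‖ + ‖t‖ * ‖f - b‖ := by
        rw [← norm_smul]; exact norm_add_le _ _
      _ ≤ 1 / 4 * ‖x‖ + (T * (5 / 4 * ‖x‖)) * (1 / (8 * T)) := by
        gcongr
        exact (hTb a ha t).trans (by gcongr)
      _ = (1 / 4 + 5 / 32) * ‖x‖ := by field_simp; ring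
      _ ≤ 1 / 2 * ‖x‖ := by gcongr; norm_num

/-- The scheme is quantified inside the induction because `G` is stripped from the scheme `A n + F`,
not from `A n`. -/
theorem approximatesWithin_of_add_submodule (F : Submodule 𝕜 X) (hF : F.FG) :
    ∀ A : ℕ → Set X, IsWeakScheme 𝕜 A → ∀ m : ℕ, ∀ c < (1 : ℝ),
      ApproximatesWithin (A m + (F : Set X)) c → ∃ k, ∃ d < 1, ApproximatesWithin (A k) d := by
  induction F, hF using Submodule.fg_induction with
  | singleton f =>
    intro A hA m c hc h
    exact hA.approximatesWithin_of_add_span_singleton f h hc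
  | sup F G _ _ ihF ihG =>
    intro A hA m c hc h
    rw [Submodule.coe_sup, ← add_assoc] at h
    obtain ⟨k, d, hd, hk⟩ := ihG _ (hA.add_submodule F) m c hc h
    exact ihF A hA k d hd hk

/-! ### Consequences of Shapiro's theorem -/

theorem bestError_le_norm (hA : IsWeakScheme 𝕜 A) (x : X) (n : ℕ) :
    bestError x (A n) ≤ ‖x‖ := by
  simpa [bestError] using Metric.infDist_le_dist_of_mem (x := x) (hA.zero_mem n)

theorem bestError_smul (hA : IsWeakScheme 𝕜 A) (c : 𝕜) (x : X) (n : ℕ) :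
    bestError (c • x) (A n) ≤ ‖c‖ * bestError x (A n) := by
  rcases eq_or_ne c 0 with rfl | hc
  · simpa using hA.bestError_le_norm (0 : X) n
  rw [← div_le_iff₀' (norm_pos_iff.2 hc), bestError, bestError,
    Metric.le_infDist ⟨0, hA.zero_mem n⟩]
  intro a ha
  rw [div_le_iff₀' (norm_pos_iff.2 hc), dist_eq_norm, ← norm_smul, smul_sub, ← dist_eq_norm]
  exact Metric.infDist_le_dist_of_mem (hA.smul_mem n c a ha)

/-- If the scheme approximates with a uniform relative error `c < 1`, the worst errors on the unit
ball tend to zero and dominate all error sequences. -/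
theorem not_satisfiesShapiro (hA : IsWeakScheme 𝕜 A) {m : ℕ} {c : ℝ} (hc : c < 1)
    (h : ApproximatesWithin (A m) c) : ¬ SatisfiesShapiro A := by
  intro hS
  let ε : ℕ → ℝ := fun n => ⨆ x : Metric.closedBall (0 : X) 1, bestError (x : X) (A n)
  have : Nonempty (Metric.closedBall (0 : X) 1) := ⟨⟨0, by simp⟩⟩
  have hbdd : ∀ n, BddAbove
      (Set.range fun x : Metric.closedBall (0 : X) 1 => bestError (x : X) (A n)) := by
    rintro n
    refine ⟨1, ?_⟩
    rintro _ ⟨x, rfl⟩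
    exact (hA.bestError_le_norm _ n).trans (mem_closedBall_zero_iff.1 x.2)
  have hε0 : ∀ n, 0 ≤ ε n := fun n => Real.iSup_nonneg fun x => Metric.infDist_nonneg
  have hanti : Antitone ε := fun n k hnk => ciSup_mono (hbdd n) fun x =>
    Metric.infDist_le_infDist_of_subset (hA.monotone hnk) ⟨0, hA.zero_mem n⟩
  have hlim : Tendsto ε atTop (𝓝 0) := by
    rw [Metric.tendsto_atTop]
    intro η hη
    obtain ⟨k, -, hk⟩ := hA.exists_approximatesWithin h hc (half_pos hη)
    refine ⟨k, fun n hn => ?_⟩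
    rw [Real.dist_eq, sub_zero, abs_of_nonneg (hε0 n)]
    refine (hanti hn).trans_lt (lt_of_le_of_lt (ciSup_le fun x => ?_) (half_lt_self hη))
    obtain ⟨a, ha, hxa⟩ := hk x
    have hx1 : ‖(x : X)‖ ≤ 1 := mem_closedBall_zero_iff.1 x.2
    calc bestError (x : X) (A k) ≤ dist (x : X) a := Metric.infDist_le_dist_of_mem ha
      _ ≤ η / 2 * ‖(x : X)‖ := by rwa [dist_eq_norm]
      _ ≤ η / 2 := mul_le_of_le_one_right (half_pos hη).le hx1
  obtain ⟨x, hx⟩ := hS ε hanti hlim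
  refine hx (IsBigO.of_bound ‖x‖ (Eventually.of_forall fun n => ?_))
  rw [Real.norm_of_nonneg (show 0 ≤ bestError x (A n) from Metric.infDist_nonneg), Real.norm_of_nonneg (hε0 n)]
  rcases eq_or_ne x 0 with rfl | hx0
  · simpa using hA.bestError_le_norm (0 : X) n
  have hx1 : ‖((‖x‖⁻¹ : ℝ) : 𝕜) • x‖ = 1 := by
    rw [norm_smul]; simp [hx0]
  have hle : bestError (((‖x‖⁻¹ : ℝ) : 𝕜) • x) (A n) ≤ ε n :=
    le_ciSup (hbdd n) ⟨((‖x‖⁻¹ : ℝ) : 𝕜) • x, mem_closedBall_zero_iff.2 hx1.le⟩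
  have hsm := hA.bestError_smul ((‖x‖ : ℝ) : 𝕜) (((‖x‖⁻¹ : ℝ) : 𝕜) • x) n
  rw [smul_smul, ← RCLike.ofReal_mul, mul_inv_cancel₀ (norm_ne_zero_iff.2 hx0),
    RCLike.ofReal_one, one_smul, RCLike.norm_ofReal, abs_norm] at hsm
  exact hsm.trans (by gcongr)

/-- In a scheme satisfying Shapiro's theorem, the errors on the unit ball of approximation by
`A n + F` have supremum `1` for each finite dimensional `F`. -/
theorem exists_lt_bestError_add (hA : IsWeakScheme 𝕜 A) (hS : SatisfiesShapiro A)
    (F : Submodule 𝕜 X) [FiniteDimensional 𝕜 F] (n : ℕ) {c : ℝ} (hc : c < 1) :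
    ∃ x : X, ‖x‖ ≤ 1 ∧ c < bestError x (A n + (F : Set X)) := by
  by_contra! hcon
  have hB := hA.add_submodule F
  obtain ⟨d, hcd, hd⟩ := exists_between (max_lt hc zero_lt_one)
  have happ : ApproximatesWithin (A n + (F : Set X)) d := fun x => by
    rcases eq_or_ne x 0 with rfl | hx0
    · exact ⟨0, hB.zero_mem n, by simp⟩
    have hx1 : ‖((‖x‖⁻¹ : ℝ) : 𝕜) • x‖ = 1 := by
      rw [norm_smul]; simp [hx0]
    have hlt := (hcon _ hx1.le).trans_lt ((le_max_left c 0).trans_lt hcd)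
    obtain ⟨a, ha, hxa⟩ := (Metric.infDist_lt_iff ⟨0, hB.zero_mem n⟩).1 hlt
    refine ⟨((‖x‖ : ℝ) : 𝕜) • a, hB.smul_mem n _ a ha, ?_⟩
    have hxe : x = ((‖x‖ : ℝ) : 𝕜) • ((‖x‖⁻¹ : ℝ) : 𝕜) • x := by
      rw [smul_smul, ← RCLike.ofReal_mul, mul_inv_cancel₀ (norm_ne_zero_iff.2 hx0),
        RCLike.ofReal_one, one_smul]
    calc ‖x - ((‖x‖ : ℝ) : 𝕜) • a‖
        = ‖((‖x‖ : ℝ) : 𝕜) • (((‖x‖⁻¹ : ℝ) : 𝕜) • x - a)‖ := by rw [smul_sub, ← hxe]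
      _ = ‖x‖ * dist (((‖x‖⁻¹ : ℝ) : 𝕜) • x) a := by
        rw [norm_smul, RCLike.norm_ofReal, abs_norm, dist_eq_norm]
      _ ≤ ‖x‖ * d := by gcongr
      _ = d * ‖x‖ := mul_comm _ _
  obtain ⟨k, e, he, hk⟩ := approximatesWithin_of_add_submodule F
    (Module.Finite.iff_fg.1 inferInstance) A hA n d hd happ
  exact hA.not_satisfiesShapiro he hk hS

theorem isFar_of_hasDSP (hA : IsWeakScheme 𝕜 A) (hS : SatisfiesShapiro A) {Y : Submodule 𝕜 X}
    (hY : HasDSP Y) : IsFar 1 Y A := by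
  intro n
  refine le_of_forall_pos_sub_le fun η hη => ?_
  -- The vector `y` found below has error above `1 - 3 * ε` and norm at most `1 + 2 * ε`; the
  -- quotient is at least `1 - 5 * ε`.
  obtain ⟨ε, hε, hεη, hε1⟩ : ∃ ε : ℝ, 0 < ε ∧ 5 * ε ≤ η ∧ ε ≤ 1 / 5 :=
    ⟨min (η / 5) (1 / 5), by positivity, by linarith [min_le_left (η / 5) (1 / 5)],
      min_le_right _ _⟩
  obtain ⟨δ, hδ, F, hF, hdef⟩ := hY ε hε
  obtain ⟨x, hx1, hx⟩ := hA.exists_lt_bestError_add hS F n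
    (show 1 - min δ ε < 1 by linarith [lt_min hδ hε])
  have hxF : 1 - δ < bestError x (F : Set X) := by
    refine lt_of_lt_of_le (lt_of_le_of_lt (by linarith [min_le_left δ ε]) hx)
      (Metric.infDist_le_infDist_of_subset (fun f hf => ⟨0, hA.zero_mem n, f, hf, zero_add f⟩)
        ⟨0, F.zero_mem⟩)
  have hxA : 1 - ε < bestError x (A n) := by
    refine lt_of_lt_of_le (lt_of_le_of_lt (by linarith [min_le_right δ ε]) hx)
      (Metric.infDist_le_infDist_of_subset (fun a ha => ⟨a, ha, 0, F.zero_mem, add_zero a⟩)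
        ⟨0, hA.zero_mem n⟩)
  obtain ⟨y, hyY, hxy⟩ := (Metric.infDist_lt_iff ⟨0, Y.zero_mem⟩).1
    ((hdef x hx1 hxF).trans_lt (by linarith : ε < 2 * ε))
  have hyA : 1 - 3 * ε < bestError y (A n) := by
    have := Metric.infDist_le_infDist_add_dist (s := A n) (x := x) (y := y)
    unfold bestError at hxA ⊢
    linarith
  have hyn : ‖y‖ ≤ 1 + 2 * ε := by
    have := norm_le_norm_add_norm_sub x y
    rw [dist_eq_norm] at hxy
    linarith
  have hy0 : y ≠ 0 := by
    rintro rfl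
    have := hA.bestError_le_norm (0 : X) n
    rw [norm_zero] at this
    linarith
  have hypos : 0 < ‖y‖ := norm_pos_iff.2 hy0
  have hz1 : ‖((‖y‖⁻¹ : ℝ) : 𝕜) • y‖ = 1 := by
    rw [norm_smul]; simp [hy0]
  have hle : bestError (((‖y‖⁻¹ : ℝ) : 𝕜) • y) (A n) ≤ setError (unitSphere Y) (A n) := by
    refine le_csSup ⟨1, ?_⟩ ⟨_, ⟨Y.smul_mem _ hyY, hz1⟩, rfl⟩
    rintro _ ⟨z, hz, rfl⟩
    exact (hA.bestError_le_norm z n).trans hz.2.le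
  have hsm := hA.bestError_smul ((‖y‖ : ℝ) : 𝕜) (((‖y‖⁻¹ : ℝ) : 𝕜) • y) n
  rw [smul_smul, ← RCLike.ofReal_mul, mul_inv_cancel₀ hypos.ne', RCLike.ofReal_one, one_smul,
    RCLike.norm_ofReal, abs_norm] at hsm
  have hs : 1 - 3 * ε < (1 + 2 * ε) * setError (unitSphere Y) (A n) :=
    hyA.trans_le (hsm.trans (mul_le_mul hyn hle Metric.infDist_nonneg (by linarith)))
  nlinarith

end IsWeakScheme

end Scheme

/-! ### Uniform convexity and finite rank perturbations of the identity -/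

section UniformlyConvex

variable {𝕜 X : Type*} [RCLike 𝕜] [NormedAddCommGroup X] [NormedSpace 𝕜 X]

/-- Uniform convexity for vectors of norm slightly larger than `1`. -/
theorem exists_norm_sub_lt_of_norm_add (X : Type*) [NormedAddCommGroup X] [NormedSpace ℝ X]
    [UniformConvexSpace X] {ε : ℝ} (hε : 0 < ε) :
    ∃ δ : ℝ, 0 < δ ∧ δ ≤ 1 ∧ ∀ x y : X, ‖x‖ ≤ 1 + δ → ‖y‖ ≤ 1 + δ → 2 - δ ≤ ‖x + y‖ →
      ‖x - y‖ < ε := by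
  obtain ⟨d, hd, H⟩ := exists_forall_closed_ball_dist_add_le_two_sub X (half_pos hε)
  -- Scaling by `(1 + δ)⁻¹` at most halves `‖x - y‖`, and `(2 - d) * (1 + δ) < 2 - δ`.
  obtain ⟨δ, hδ, hδ1, hδd⟩ : ∃ δ : ℝ, 0 < δ ∧ δ ≤ 1 ∧ 4 * δ ≤ d :=
    ⟨min 1 (d / 4), by positivity, min_le_left _ _, by linarith [min_le_right 1 (d / 4)]⟩
  refine ⟨δ, hδ, hδ1, fun x y hx hy hxy => ?_⟩
  by_contra! hcon
  have h1 : 0 < 1 + δ := by linarith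
  have hn : ∀ z : X, ‖(1 + δ)⁻¹ • z‖ = ‖z‖ / (1 + δ) := fun z => by
    rw [norm_smul_of_nonneg (inv_nonneg.2 h1.le), inv_mul_eq_div]
  have := H (x := (1 + δ)⁻¹ • x) (by rwa [hn, div_le_one h1]) (y := (1 + δ)⁻¹ • y)
    (by rwa [hn, div_le_one h1]) (by
      rw [← smul_sub, hn, le_div_iff₀ h1]
      nlinarith)
  rw [← smul_add, hn, div_le_iff₀ h1] at this
  nlinarith

theorem exists_lt_re_apply (g : X →L[𝕜] 𝕜) {c : ℝ} (hc : c < ‖g‖) :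
    ∃ x : X, ‖x‖ ≤ 1 ∧ c < RCLike.re (g x) := by
  obtain ⟨x, hx, hgx⟩ := g.exists_lt_apply_of_lt_opNorm hc
  obtain ⟨s, hs, hsg⟩ := RCLike.exists_norm_eq_mul_self (g x)
  refine ⟨s • x, by rw [norm_smul, hs, one_mul]; exact hx.le, ?_⟩
  rwa [map_smul, smul_eq_mul, ← hsg, RCLike.ofReal_re]

/-- The operator `v` differs from the identity by an operator of finite rank. -/
def IsFiniteRankPerturbation (v : X →L[𝕜] X) : Prop :=
  ∃ F : Submodule 𝕜 X, FiniteDimensional 𝕜 F ∧ ∀ x, x - v x ∈ F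

theorem IsFiniteRankPerturbation.comp {v w : X →L[𝕜] X} (hv : IsFiniteRankPerturbation v)
    (hw : IsFiniteRankPerturbation w) : IsFiniteRankPerturbation (v.comp w) := by
  obtain ⟨F, hF, hvF⟩ := hv
  obtain ⟨G, hG, hwG⟩ := hw
  refine ⟨F ⊔ G, inferInstance, fun x => ?_⟩
  have : x - v.comp w x = (w x - v (w x)) + (x - w x) := by
    simp
  rw [this]
  exact Submodule.add_mem_sup (hvF _) (hwG _)

theorem IsFiniteRankPerturbation.half_smul_add {v w : X →L[𝕜] X}
    (hv : IsFiniteRankPerturbation v) (hw : IsFiniteRankPerturbation w) :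
    IsFiniteRankPerturbation ((2⁻¹ : 𝕜) • (v + w)) := by
  obtain ⟨F, hF, hvF⟩ := hv
  obtain ⟨G, hG, hwG⟩ := hw
  refine ⟨F ⊔ G, inferInstance, fun x => ?_⟩
  have : x - ((2⁻¹ : 𝕜) • (v + w)) x = (2⁻¹ : 𝕜) • ((x - v x) + (x - w x)) := by
    simp only [_root_.smul_apply, _root_.add_apply]
    module
  rw [this]
  exact Submodule.smul_mem _ _ (Submodule.add_mem_sup (hvF _) (hwG _))

theorem isFiniteRankPerturbation_id : IsFiniteRankPerturbation (ContinuousLinearMap.id 𝕜 X) :=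
  ⟨⊥, inferInstance, fun x => by simp⟩

theorem HasRMAP.exists_apply_eq_zero (h : HasRMAP 𝕜 X) (x : X) {δ : ℝ} (hδ : 0 < δ) :
    ∃ w : X →L[𝕜] X, IsFiniteRankPerturbation w ∧ ‖w‖ < 1 + δ ∧ w x = 0 := by
  obtain ⟨u, hu, hux, hn⟩ := h (Submodule.span 𝕜 {x}) inferInstance δ hδ
  refine ⟨ContinuousLinearMap.id 𝕜 X - u, ⟨_, hu, fun z => ⟨z, by simp⟩⟩, hn, ?_⟩
  simp [hux x (Submodule.mem_span_singleton_self x)]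

/-- Under uniform convexity and the reverse metric approximation property, composing a functional
with a near-contractive finite rank perturbation of the identity can reduce its norm by a fixed
factor. -/
theorem HasRMAP.exists_norm_comp_le (h : HasRMAP 𝕜 X) (huc : UniformConvexSpace X) :
    ∃ θ : ℝ, 0 < θ ∧ θ < 1 ∧ ∀ g : X →L[𝕜] 𝕜, ∀ δ : ℝ, 0 < δ →
      ∃ v : X →L[𝕜] X, IsFiniteRankPerturbation v ∧ ‖v‖ < 1 + δ ∧
        ‖g.comp v‖ ≤ (1 - θ) * ‖g‖ := by
  let : NormedSpace ℝ X := NormedSpace.restrictScalars ℝ 𝕜 X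
  obtain ⟨d, hd, hd1, huc⟩ := exists_norm_sub_lt_of_norm_add X (show (0 : ℝ) < 1 / 4 by norm_num)
  obtain ⟨θ, hθ, hθd⟩ : ∃ θ : ℝ, 0 < θ ∧ 8 * θ = d := ⟨d / 8, by positivity, by ring⟩
  refine ⟨θ, hθ, by linarith, ?_⟩
  have key : ∀ g : X →L[𝕜] 𝕜, ‖g‖ = 1 → ∀ δ : ℝ, 0 < δ →
      ∃ v : X →L[𝕜] X, IsFiniteRankPerturbation v ∧ ‖v‖ < 1 + δ ∧ ‖g.comp v‖ ≤ 1 - θ := by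
    intro g hg δ hδ
    obtain ⟨η, hη, hηδ, hηθ⟩ : ∃ η : ℝ, 0 < η ∧ 3 * η ≤ δ ∧ η ≤ θ :=
      ⟨min (δ / 3) θ, by positivity, by linarith [min_le_left (δ / 3) θ], min_le_right _ _⟩
    obtain ⟨x, hx1, hgx⟩ := exists_lt_re_apply g (c := 1 - θ) (by linarith)
    obtain ⟨w, hwf, hwn, hwx⟩ := h.exists_apply_eq_zero x hη
    have hww : ‖w.comp w‖ ≤ 1 + 3 * η := by
      refine (w.opNorm_comp_le w).trans ?_
      nlinarith [norm_nonneg w]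
    -- If `g` composed with this average were large at `y`, `g` would be nearly maximal at both `w
    -- y` and `w (w y)`. The first puts `w y` near `x`, where `g` is also nearly maximal; as `w x =
    -- 0`, `w (w y)` is then small, against the second.
    refine ⟨(2⁻¹ : 𝕜) • (w + w.comp w), hwf.half_smul_add (hwf.comp hwf), ?_, ?_⟩
    · rw [norm_smul, norm_inv, RCLike.norm_ofNat]
      have := norm_add_le w (w.comp w)
      linarith
    by_contra! hcon
    obtain ⟨y, hy1, hgy⟩ := exists_lt_re_apply _ hcon
    have hre : ∀ z : X, RCLike.re (g z) ≤ ‖z‖ := fun z =>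
      (RCLike.re_le_norm _).trans (by simpa [hg] using g.le_opNorm z)
    have hval : RCLike.re ((g.comp ((2⁻¹ : 𝕜) • (w + w.comp w))) y)
        = 2⁻¹ * (RCLike.re (g (w y)) + RCLike.re (g (w (w y)))) := by
      have h2 : (2⁻¹ : 𝕜) = ((2⁻¹ : ℝ) : 𝕜) := by push_cast; rfl
      simp only [ContinuousLinearMap.comp_apply, _root_.smul_apply,
        _root_.add_apply, map_smul, map_add, smul_eq_mul]
      rw [h2, RCLike.re_ofReal_mul, map_add]
    rw [hval] at hgy
    have hwy : ‖w y‖ ≤ 1 + η := by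
      refine (w.le_opNorm y).trans ?_
      nlinarith [norm_nonneg w, norm_nonneg y]
    have hwwy : ‖w (w y)‖ ≤ 1 + 3 * η := by
      refine ((w.comp w).le_opNorm y).trans ?_
      nlinarith [norm_nonneg (w.comp w), norm_nonneg y]
    have h1 := hre (w y)
    have h2 := hre (w (w y))
    have h3 := hre (x + w y)
    rw [map_add, map_add] at h3
    have hclose := huc x (w y) (by linarith) (by linarith) (by linarith)
    have hsmall : ‖w (w y)‖ ≤ 2 * (1 / 4) := by
      calc ‖w (w y)‖ = ‖w (x - w y)‖ := by rw [map_sub, hwx, zero_sub, norm_neg]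
        _ ≤ ‖w‖ * ‖x - w y‖ := w.le_opNorm _
        _ ≤ 2 * (1 / 4) := by
          gcongr
          linarith
    linarith
  intro g δ hδ
  rcases eq_or_ne g 0 with rfl | hg
  · exact ⟨ContinuousLinearMap.id 𝕜 X, isFiniteRankPerturbation_id,
      ContinuousLinearMap.norm_id_le.trans_lt (by linarith), by simp⟩
  have hgpos : 0 < ‖g‖ := norm_pos_iff.2 hg
  obtain ⟨v, hvf, hvn, hv⟩ := key (((‖g‖⁻¹ : ℝ) : 𝕜) • g) (by rw [norm_smul]; simp [hg]) δ hδ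
  refine ⟨v, hvf, hvn, ?_⟩
  rw [ContinuousLinearMap.smul_comp, norm_smul, RCLike.norm_ofReal, abs_inv, abs_norm,
    inv_mul_le_iff₀ hgpos] at hv
  linarith

theorem exists_pos_norm_comp_lt {δ : ℝ} (hδ : 0 < δ) :
    ∃ η : ℝ, 0 < η ∧ η ≤ 1 ∧ ∀ v w : X →L[𝕜] X, ‖v‖ < 1 + η → ‖w‖ < 1 + η →
      ‖v.comp w‖ < 1 + δ := by
  obtain ⟨η, hη, hη1, hηδ⟩ : ∃ η : ℝ, 0 < η ∧ η ≤ 1 ∧ 3 * η ≤ δ :=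
    ⟨min 1 (δ / 3), by positivity, min_le_left _ _, by linarith [min_le_right 1 (δ / 3)]⟩
  refine ⟨η, hη, hη1, fun v w hv hw => (v.opNorm_comp_le w).trans_lt ?_⟩
  have := mul_lt_mul'' hv hw (norm_nonneg v) (norm_nonneg w)
  nlinarith

/-- The factor `1 - θ` does not depend on the functional, so the reduction can be repeated on
`g.comp v`. -/
theorem HasRMAP.exists_norm_comp_lt (h : HasRMAP 𝕜 X) (huc : UniformConvexSpace X)
    (g : X →L[𝕜] 𝕜) {ε δ : ℝ} (hε : 0 < ε) (hδ : 0 < δ) :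
    ∃ v : X →L[𝕜] X, IsFiniteRankPerturbation v ∧ ‖v‖ < 1 + δ ∧ ‖g.comp v‖ < ε := by
  obtain ⟨θ, hθ, hθ1, H⟩ := h.exists_norm_comp_le huc
  have key : ∀ n : ℕ, ∀ δ : ℝ, 0 < δ → ∃ v : X →L[𝕜] X, IsFiniteRankPerturbation v ∧
      ‖v‖ < 1 + δ ∧ ‖g.comp v‖ ≤ (1 - θ) ^ n * ‖g‖ := by
    intro n
    induction n with
    | zero =>
      intro δ hδ
      exact ⟨ContinuousLinearMap.id 𝕜 X, isFiniteRankPerturbation_id,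
        ContinuousLinearMap.norm_id_le.trans_lt (by linarith), by simp⟩
    | succ n ih =>
      intro δ hδ
      obtain ⟨η, hη, -, hcomp⟩ := exists_pos_norm_comp_lt (𝕜 := 𝕜) (X := X) hδ
      obtain ⟨v, hvf, hvn, hv⟩ := ih η hη
      obtain ⟨w, hwf, hwn, hw⟩ := H (g.comp v) η hη
      refine ⟨v.comp w, hvf.comp hwf, hcomp v w hvn hwn, hw.trans ?_⟩
      rw [pow_succ', mul_assoc]
      exact mul_le_mul_of_nonneg_left hv (by linarith)
  obtain ⟨n, hn⟩ := exists_pow_lt_of_lt_one (show 0 < ε / (‖g‖ + 1) by positivity)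
    (show 1 - θ < 1 by linarith)
  obtain ⟨v, hvf, hvn, hv⟩ := key n δ hδ
  refine ⟨v, hvf, hvn, hv.trans_lt ?_⟩
  rw [lt_div_iff₀ (by positivity)] at hn
  have : 0 < (1 - θ) ^ n := pow_pos (by linarith) n
  linarith

theorem HasRMAP.exists_forall_norm_comp_lt (h : HasRMAP 𝕜 X) (huc : UniformConvexSpace X)
    {ι : Type*} (s : Finset ι) (f : ι → X →L[𝕜] 𝕜) :
    ∀ ε δ : ℝ, 0 < ε → 0 < δ → ∃ v : X →L[𝕜] X, IsFiniteRankPerturbation v ∧ ‖v‖ < 1 + δ ∧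
      ∀ i ∈ s, ‖(f i).comp v‖ < ε := by
  classical
  induction s using Finset.induction_on with
  | empty =>
    intro ε δ _ hδ
    exact ⟨ContinuousLinearMap.id 𝕜 X, isFiniteRankPerturbation_id,
      ContinuousLinearMap.norm_id_le.trans_lt (by linarith), by simp⟩
  | insert i s _ ih =>
    intro ε δ hε hδ
    obtain ⟨η, hη, hη1, hcomp⟩ := exists_pos_norm_comp_lt (𝕜 := 𝕜) (X := X) hδ
    -- Half of `ε` suffices: composing on the right with `w` costs a factor `‖w‖ < 2`.
    obtain ⟨v, hvf, hvn, hv⟩ := ih (ε / 2) η (half_pos hε) hη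
    obtain ⟨w, hwf, hwn, hw⟩ := h.exists_norm_comp_lt huc ((f i).comp v) hε hη
    refine ⟨v.comp w, hvf.comp hwf, hcomp v w hvn hwn, fun j hj => ?_⟩
    rcases Finset.mem_insert.1 hj with rfl | hj
    · exact hw
    calc ‖(f j).comp (v.comp w)‖ ≤ ‖(f j).comp v‖ * ‖w‖ :=
          ((f j).comp v).opNorm_comp_le w
      _ < ε / 2 * 2 := mul_lt_mul'' (hv j hj) (by linarith) (norm_nonneg _) (norm_nonneg _)
      _ = ε := by ring

/-! ### The Defining Subspace Property -/

theorem exists_bestError_le_of_finiteDimensional_quotient (Y : Submodule 𝕜 X)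
    [FiniteDimensional 𝕜 (X ⧸ Y)] :
    ∃ (n : ℕ) (f : Fin n → X →L[𝕜] 𝕜) (C : ℝ), 0 ≤ C ∧ ∀ x : X, ∀ r : ℝ, 0 ≤ r →
      (∀ i, ‖f i x‖ ≤ r) → bestError x (Y : Set X) ≤ C * r := by
  -- `Y` need not be closed; passing to the closure keeps distances and makes the quotient seminorm
  -- a norm.
  let Z := Y.topologicalClosure
  have : IsClosed (Z : Set X) := Y.isClosed_topologicalClosure
  have : FiniteDimensional 𝕜 (X ⧸ Z) :=
    Module.Finite.of_surjective (Submodule.factor Y.le_topologicalClosure)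
      (Submodule.factor_surjective _)
  let e : (X ⧸ Z) ≃L[𝕜] (Fin (Module.finrank 𝕜 (X ⧸ Z)) → 𝕜) :=
    (Module.finBasis 𝕜 (X ⧸ Z)).equivFunL
  let q : X →L[𝕜] (Fin (Module.finrank 𝕜 (X ⧸ Z)) → 𝕜) :=
    (e : (X ⧸ Z) →L[𝕜] (Fin (Module.finrank 𝕜 (X ⧸ Z)) → 𝕜)).comp Z.mkQL
  refine ⟨_, fun i => (ContinuousLinearMap.proj i).comp q,
    ‖(e.symm : (Fin (Module.finrank 𝕜 (X ⧸ Z)) → 𝕜) →L[𝕜] (X ⧸ Z))‖, norm_nonneg _,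
    fun x r hr hx => ?_⟩
  have hq : ‖q x‖ ≤ r := (pi_norm_le_iff_of_nonneg hr).2 hx
  calc bestError x (Y : Set X) = Metric.infDist x (Z : Set X) := by
        rw [Submodule.topologicalClosure_coe, Metric.infDist_closure, bestError]
    _ = ‖Z.mkQ x‖ := (QuotientAddGroup.norm_mk (S := Z.toAddSubgroup) x).symm
    _ = ‖(e.symm : (Fin (Module.finrank 𝕜 (X ⧸ Z)) → 𝕜) →L[𝕜] (X ⧸ Z)) (q x)‖ := by
        simp [q]
    _ ≤ _ := (ContinuousLinearMap.le_opNorm _ _).trans (by gcongr)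

theorem HasRMAP.hasDSP (h : HasRMAP 𝕜 X) (huc : UniformConvexSpace X) (Y : Submodule 𝕜 X)
    [FiniteDimensional 𝕜 (X ⧸ Y)] : HasDSP Y := by
  intro ε hε
  let : NormedSpace ℝ X := NormedSpace.restrictScalars ℝ 𝕜 X
  obtain ⟨n, f, C, hC, hf⟩ := exists_bestError_le_of_finiteDimensional_quotient Y
  obtain ⟨δ, hδ, -, hconv⟩ := exists_norm_sub_lt_of_norm_add X (half_pos hε)
  obtain ⟨v, ⟨F, hF, hvF⟩, hvn, hv⟩ := h.exists_forall_norm_comp_lt huc Finset.univ f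
    (ε / (2 * (C + 1))) δ (by positivity) hδ
  refine ⟨δ / 2, by positivity, F, hF, fun x hx1 hx => ?_⟩
  have hvx : ‖v x‖ ≤ 1 + δ := by
    refine (v.le_opNorm x).trans ?_
    nlinarith [norm_nonneg v, norm_nonneg x]
  -- The midpoint differs from `x` by half of `x - v x`, an element of `F`.
  have hmid : 1 - δ / 2 < ‖(2⁻¹ : 𝕜) • (x + v x)‖ := by
    refine hx.trans_le ((Metric.infDist_le_dist_of_mem
      (F.smul_mem (2⁻¹ : 𝕜) (hvF x))).trans_eq ?_)
    rw [dist_eq_norm]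
    congr 1
    module
  rw [norm_smul, norm_inv, RCLike.norm_ofNat] at hmid
  have hclose := hconv x (v x) (by linarith) hvx (by linarith)
  have hvY : bestError (v x) (Y : Set X) ≤ ε / 2 := by
    refine (hf (v x) (ε / (2 * (C + 1))) (by positivity) fun i => ?_).trans ?_
    · refine (((f i).comp v).le_opNorm x).trans ?_
      have := (hv i (Finset.mem_univ i)).le
      exact (mul_le_of_le_one_right (norm_nonneg _) hx1).trans this
    · rw [← mul_div_assoc, div_le_iff₀ (by positivity)]
      nlinarith
  have := Metric.infDist_le_infDist_add_dist (s := (Y : Set X)) (x := x) (y := v x)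
  rw [dist_eq_norm] at this
  unfold bestError at hvY ⊢
  linarith

end UniformlyConvex

end ApproxLethargy

theorem theorem6p2 {𝕜 X : Type*} [RCLike 𝕜] [NormedAddCommGroup X] [NormedSpace 𝕜 X]
    [CompleteSpace X] :
    (∀ A : ℕ → Set X, ApproxLethargy.IsApproximationScheme 𝕜 A →
      ApproxLethargy.SatisfiesShapiro A →
      ∀ Y : Submodule 𝕜 X, FiniteDimensional 𝕜 (X ⧸ Y) → ApproxLethargy.HasDSP Y →
        ApproxLethargy.IsFar 1 Y A) ∧
    (UniformConvexSpace X → ApproxLethargy.HasRMAP 𝕜 X →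
      ∀ Y : Submodule 𝕜 X, FiniteDimensional 𝕜 (X ⧸ Y) → ApproxLethargy.HasDSP Y) ∧
    (UniformConvexSpace X → ApproxLethargy.HasRMAP 𝕜 X →
      ∀ A : ℕ → Set X, ApproxLethargy.IsApproximationScheme 𝕜 A →
        ApproxLethargy.SatisfiesShapiro A →
        ∀ Y : Submodule 𝕜 X, FiniteDimensional 𝕜 (X ⧸ Y) → ApproxLethargy.IsFar 1 Y A) := by
  have h1 : ∀ A : ℕ → Set X, ApproxLethargy.IsApproximationScheme 𝕜 A →
      ApproxLethargy.SatisfiesShapiro A →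
      ∀ Y : Submodule 𝕜 X, FiniteDimensional 𝕜 (X ⧸ Y) → ApproxLethargy.HasDSP Y →
        ApproxLethargy.IsFar 1 Y A := fun _ hA hS _ _ hY => hA.isWeakScheme.isFar_of_hasDSP hS hY
  have h2 : UniformConvexSpace X → ApproxLethargy.HasRMAP 𝕜 X →
      ∀ Y : Submodule 𝕜 X, FiniteDimensional 𝕜 (X ⧸ Y) → ApproxLethargy.HasDSP Y :=
    fun huc h Y _ => h.hasDSP huc Y
  exact ⟨h1, h2, fun huc h A hA hS Y hY => h1 A hA hS Y hY (h2 huc h Y hY)⟩
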